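/- A locally finite signed measure on $\mathbb R$ is a real-valued, countably additive function $\omega$ on the bounded Borel subsets of $\mathbb R$. Let $\Omega$ be the set of all of them, with the $\sigma$-algebra generated by the evaluations $\omega\mapsto\omega(s)$ ($s$ bounded Borel) and with the translations $(T_x\omega)(s)=\omega(s+x)$, $x\in\mathbb R$. A stationary locally integrable process $X$ on $\mathbb R$ is a stationary random locally finite signed measure, that is, a probability measure $\mathbb P$ on $\Omega$ that is invariant under all $T_x$; its integrals over intervals are $F_\omega(a,b)=\int_a^b X_\omega(x)\,dx:=\omega((a,b])$ for $-\infty<a<b<\infty$. **Theorem.** Let $\mathbb P$ be a stationary locally integrable process $X$ on $\mathbb R$. The following are equivalent. (i) $X$ is the derivative of a stationary process given by a covariant functional: there is a function $(\omega,x)\mapsto\mathcal E_\omega(x)\in\mathbb R$ on $\Omega\times\mathbb R$, measurable in $\omega$ for each $x$, such that $\mathcal E_\omega(x)=\mathcal E_{T_x\omega}(0)$ for all $\omega\in\Omega$ and $x\in\mathbb R$, the process $x\mapsto\mathcal E_\omega(x)$ is stationary under $\mathbb P$, and for $\mathbb P$-almost every $\omega$, $$F_\omega(a,b)=\mathcal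 E_\omega(b)-\mathcal E_\omega(a)\qquad\text{for all } a<b.$$ (ii) The random variables $F_\omega(a,b)$, $-\infty<a<b<\infty$, form a tight family: there is a non-increasing function $p:\mathbb R\to\mathbb R$ with $p(t)\to0$ as $t\to\infty$ such that $\mathbb P(|F_\omega(a,b)|\ge t)\le p(t)$ for all $a<b$ and all $t$. -/

import Mathlib

open MeasureTheory Filter Topology

/-- A locally finite signed measure on `ℝ`: a real-valued countably additive function on the
bounded Borel sets. As for Mathlib's `VectorMeasure`, the value on all other sets is `0`
by convention, so that two such measures are equal iff they agree on bounded Borel sets. -/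
@[ext]
structure LocSignedMeasure where
  /-- the value `ω(s)` -/
  toFun : Set ℝ → ℝ
  eq_zero_of_not : ∀ s, ¬ (MeasurableSet s ∧ Bornology.IsBounded s) → toFun s = 0
  hasSum_iUnion : ∀ f : ℕ → Set ℝ, (∀ i, MeasurableSet (f i)) →
    Pairwise (fun i j => Disjoint (f i) (f j)) → Bornology.IsBounded (⋃ i, f i) →
    HasSum (fun i => toFun (f i)) (toFun (⋃ i, f i))

namespace LocSignedMeasure

/-- The usual σ-algebra on the space of locally finite signed measures, generated by the
evaluations `ω ↦ ω(s)`, `s` bounded Borel (the other evaluations are constant). -/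
instance : MeasurableSpace LocSignedMeasure :=
  ⨆ s : Set ℝ, MeasurableSpace.comap (fun ω : LocSignedMeasure => ω.toFun s) inferInstance

theorem isBounded_preimage_sub (x : ℝ) {s : Set ℝ} (hs : Bornology.IsBounded s) :
    Bornology.IsBounded ((fun y : ℝ => y - x) ⁻¹' s) := by
  obtain ⟨R, hR⟩ := hs.exists_norm_le
  refine isBounded_iff_forall_norm_le.2 ⟨R + ‖x‖, fun y hy => ?_⟩
  calc ‖y‖ = ‖(y - x) + x‖ := by rw [sub_add_cancel]
    _ ≤ ‖y - x‖ + ‖x‖ := norm_add_le _ _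
    _ ≤ R + ‖x‖ := by gcongr; exact hR _ hy

theorem isBounded_of_preimage_sub (x : ℝ) {s : Set ℝ}
    (hs : Bornology.IsBounded ((fun y : ℝ => y - x) ⁻¹' s)) : Bornology.IsBounded s := by
  have h := isBounded_preimage_sub (-x) hs
  have e : (fun y : ℝ => y - -x) ⁻¹' ((fun y : ℝ => y - x) ⁻¹' s) = s := by
    ext y; simp
  rwa [e] at h

theorem measurableSet_of_preimage_sub (x : ℝ) {s : Set ℝ}
    (hs : MeasurableSet ((fun y : ℝ => y - x) ⁻¹' s)) : MeasurableSet s := by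
  have h := (measurable_id.sub_const (-x)) hs
  have e : (fun y : ℝ => id y - -x) ⁻¹' ((fun y : ℝ => y - x) ⁻¹' s) = s := by
    ext y; simp
  rwa [e] at h

/-- The translate `T_x ω`, with `(T_x ω)(s) = ω(s + x)`: the preimage below is
`s + x = {y | y - x ∈ s}`. In terms of densities, `X_{T_x ω}(y) = X_ω(y + x)`. -/
def shift (x : ℝ) (ω : LocSignedMeasure) : LocSignedMeasure where
  toFun s := ω.toFun ((fun y : ℝ => y - x) ⁻¹' s)
  eq_zero_of_not s hs := ω.eq_zero_of_not _ fun h =>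
    hs ⟨measurableSet_of_preimage_sub x h.1, isBounded_of_preimage_sub x h.2⟩
  hasSum_iUnion f hf hd hb := by
    rw [Set.preimage_iUnion]
    refine ω.hasSum_iUnion _ (fun i => (measurable_id.sub_const x) (hf i))
      (fun i j hij => (hd hij).preimage _) ?_
    rw [← Set.preimage_iUnion]
    exact isBounded_preimage_sub x hb

/-- The interval integral `F_ω(a,b) = ∫_a^b X_ω(x) dx = ω((a,b])`. -/
def F (ω : LocSignedMeasure) (a b : ℝ) : ℝ := ω.toFun (Set.Ioc a b)

/-- `P` is (the law of) a stationary random locally finite signed measure, i.e. a stationary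
locally integrable process: `P` is invariant under all translations. -/
def IsStationary (P : Measure LocSignedMeasure) : Prop :=
  ∀ x : ℝ, MeasurePreserving (shift x) P P

/-- `E_ω(x)` is a covariant functional of `ω`: `E_ω(x) = E_{T_x ω}(0)`. -/
def IsCovariant (E : LocSignedMeasure → ℝ → ℝ) : Prop :=
  ∀ ω x, E ω x = E (shift x ω) 0

/-- The real process `x ↦ E_ω(x)`, `x ∈ ℝ`, is stationary under `P`: each `E_ω(x)` is a random
variable, and the law of the process `(E_ω(x + t))_x` does not depend on `t`. -/
def IsStationaryProcess (P : Measure LocSignedMeasure) (E : LocSignedMeasure → ℝ → ℝ) : Prop :=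
  (∀ x, Measurable fun ω => E ω x) ∧
    ∀ t, P.map (fun ω x => E ω (x + t)) = P.map (fun ω x => E ω x)

/-- The process `E` is an antiderivative of the random measure with law `P` (which is then the
derivative of `E`): almost surely, `F_ω(a,b) = E_ω(b) - E_ω(a)` for all `a < b`. -/
def IsAntiderivative (P : Measure LocSignedMeasure) (E : LocSignedMeasure → ℝ → ℝ) : Prop :=
  ∀ᵐ ω ∂P, ∀ a b : ℝ, a < b → F ω a b = E ω b - E ω a

/-- The interval integrals `F_ω(a,b)`, `a < b`, form a tight family of random variables:
`P(|F_ω(a,b)| ≥ t) ≤ p(t)` uniformly in `a < b`, where `p(t)` decreases to `0` as `t → ∞`. -/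
def HasTightIntegrals (P : Measure LocSignedMeasure) : Prop :=
  ∃ p : ℝ → ℝ, Antitone p ∧ Tendsto p atTop (𝓝 0) ∧
    ∀ a b : ℝ, a < b → ∀ t : ℝ, P.real {ω | t ≤ |F ω a b|} ≤ p t

end LocSignedMeasure

/-! The integral `c_x(ω)` of the process from `0` to `x` is an additive cocycle over the translation
flow, and a covariant antiderivative exists exactly when it is a coboundary, `c_x(ω) = g(T_x ω) -
g(ω)`; then `E_ω(x) = g(T_x ω)`. Coboundaries are tight by stationarity. The converse is Schmidt's
theorem (`exists_coboundary_of_tight`).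

The skew products `(ω, s) ↦ (T_x ω, s + c_x(ω))` preserve `P × Lebesgue`, hence act by isometries on
`L²`. The closed convex hull of the orbit of a Gaussian bump in `s` has a fixed point, its element
of least norm. Tightness keeps mass of the bump near `s = 0`, so the fixed point `f` vanishes on
almost no fibre (`exists_invariant_density`). Invariance says that the fibre density `f(ω, ·)²`,
moved by `c_x(ω)`, is the one at `T_x ω`; its median is therefore a transfer function, for each `x`
outside a null set. `exists_perfect_coboundary` makes this null set independent of `x`. -/

/-! ### Common fixed points of isometries in a Hilbert space. -/

section FixedPoint

variable {H ι : Type*} [NormedAddCommGroup H] [InnerProductSpace ℝ H] [CompleteSpace H]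

/-- A closed convex nonempty set that is mapped into itself by a family of linear isometries
contains a common fixed point, namely its element of least norm. -/
theorem Convex.exists_fixed_of_isClosed {K : Set H} (hK : Convex ℝ K) (hc : IsClosed K)
    (hne : K.Nonempty) (V : ι → H →ₗᵢ[ℝ] H) (hV : ∀ i, Set.MapsTo (V i) K K) :
    ∃ h ∈ K, ∀ i, V i h = h := by
  obtain ⟨h, hh, hmin⟩ := exists_norm_eq_iInf_of_complete_convex hne hc.isComplete hK 0
  refine ⟨h, hh, fun i => ?_⟩
  -- Minimality gives `‖h‖² ≤ ⟪V h, h⟫`; as `‖V h‖ = ‖h‖`, this forces `‖V h - h‖² ≤ 0`.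
  have h1 := (norm_eq_iInf_iff_real_inner_le_zero hK hh).1 hmin (V i h) (hV i hh)
  have h2 : ‖V i h‖ = ‖h‖ := (V i).norm_map h
  have h3 : ‖V i h - h‖ ^ 2 = ‖V i h‖ ^ 2 - 2 * inner ℝ (V i h) h + ‖h‖ ^ 2 := norm_sub_sq_real _ _
  rw [zero_sub, inner_neg_left, inner_sub_right, real_inner_self_eq_norm_sq,
    real_inner_comm] at h1
  rw [h2] at h3
  have h4 : ‖V i h - h‖ ^ 2 ≤ 0 := by linarith
  exact sub_eq_zero.1 (norm_eq_zero.1 (pow_eq_zero_iff two_ne_zero |>.1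
    (le_antisymm h4 (sq_nonneg _))))

/-- The closed convex hull of a set that is mapped into itself by a family of linear isometries
contains a common fixed point. -/
theorem exists_fixed_mem_closedConvexHull {S : Set H} (hne : S.Nonempty)
    (V : ι → H →ₗᵢ[ℝ] H) (hV : ∀ i, Set.MapsTo (V i) S S) :
    ∃ h ∈ closedConvexHull ℝ S, ∀ i, V i h = h := by
  refine Convex.exists_fixed_of_isClosed convex_closedConvexHull isClosed_closedConvexHull
    (hne.mono subset_closedConvexHull) V fun i f hf => ?_
  have hsub : closedConvexHull ℝ S ⊆ V i ⁻¹' closedConvexHull ℝ S :=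
    closedConvexHull_min (fun g hg => subset_closedConvexHull (hV i hg))
      (convex_closedConvexHull.is_linear_preimage (V i).toLinearMap.isLinear)
      (isClosed_closedConvexHull.preimage (V i).continuous)
  exact hsub hf

end FixedPoint

/-! ### Medians of densities: equivariance and measurability. -/

section Median

open scoped ENNReal

/-- The points to the left of which at least half of the mass of the density `f` lies. -/
def upperHalfSet (f : ℝ → ℝ≥0∞) : Set ℝ :=
  {u | ∫⁻ s, f s ≤ 2 * ∫⁻ s in Set.Iic u, f s}

/-- The (least) median of the measure with density `f`. -/
noncomputable def densityMedian (f : ℝ → ℝ≥0∞) : ℝ := sInf (upperHalfSet f)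

theorem upperHalfSet_mono {f : ℝ → ℝ≥0∞} {u v : ℝ} (huv : u ≤ v) (hu : u ∈ upperHalfSet f) :
    v ∈ upperHalfSet f :=
  le_trans hu (mul_le_mul_right (lintegral_mono_set (Set.Iic_subset_Iic.2 huv)) _)

theorem nonempty_upperHalfSet {f : ℝ → ℝ≥0∞} (hf0 : ∫⁻ s, f s ≠ 0) (hf : ∫⁻ s, f s ≠ ∞) :
    (upperHalfSet f).Nonempty := by
  have h1 : Tendsto (fun n : ℕ => (volume.withDensity f) (Set.Iic (n : ℝ))) atTop
      (𝓝 ((volume.withDensity f) (⋃ n : ℕ, Set.Iic (n : ℝ)))) :=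
    tendsto_measure_iUnion_atTop fun i j hij => Set.Iic_subset_Iic.2 (by exact_mod_cast hij)
  have h2 : (⋃ n : ℕ, Set.Iic (n : ℝ)) = Set.univ :=
    Set.iUnion_eq_univ_iff.2 fun x => exists_nat_ge x
  rw [h2, withDensity_apply _ MeasurableSet.univ, Measure.restrict_univ] at h1
  obtain ⟨n, hn⟩ := (h1.eventually (lt_mem_nhds (ENNReal.half_lt_self hf0 hf))).exists
  rw [withDensity_apply _ measurableSet_Iic] at hn
  refine ⟨n, ?_⟩
  have := (ENNReal.div_le_iff_le_mul (Or.inl two_ne_zero) (Or.inl (by simp))).1 hn.le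
  rwa [mul_comm] at this

theorem bddBelow_upperHalfSet {f : ℝ → ℝ≥0∞} (hf0 : ∫⁻ s, f s ≠ 0) (hf : ∫⁻ s, f s ≠ ∞) :
    BddBelow (upperHalfSet f) := by
  have hfin : IsFiniteMeasure (volume.withDensity f) := isFiniteMeasure_withDensity hf
  have h1 : Tendsto (fun n : ℕ => (volume.withDensity f) (Set.Iic (-n : ℝ))) atTop
      (𝓝 ((volume.withDensity f) (⋂ n : ℕ, Set.Iic (-n : ℝ)))) :=
    tendsto_measure_iInter_atTop (fun _ => measurableSet_Iic.nullMeasurableSet)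
      (fun i j hij => Set.Iic_subset_Iic.2 (by simpa using hij)) ⟨0, measure_ne_top _ _⟩
  have h2 : (⋂ n : ℕ, Set.Iic (-n : ℝ)) = ∅ := by
    refine Set.eq_empty_of_forall_notMem fun x hx => ?_
    obtain ⟨n, hn⟩ := exists_nat_gt (-x)
    have := Set.mem_iInter.1 hx n
    rw [Set.mem_Iic] at this
    linarith
  rw [h2, measure_empty] at h1
  obtain ⟨n, hn⟩ := (h1.eventually (gt_mem_nhds (ENNReal.half_pos hf0))).exists
  rw [withDensity_apply _ measurableSet_Iic] at hn
  refine ⟨-n, fun u hu => ?_⟩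
  by_contra! hlt
  have h3 := upperHalfSet_mono hlt.le hu
  have h4 := (ENNReal.lt_div_iff_mul_lt (Or.inl two_ne_zero) (Or.inl (by simp))).1 hn
  rw [mul_comm] at h4
  exact absurd h3 (not_le.2 h4)

theorem mem_upperHalfSet_add_iff {f g : ℝ → ℝ≥0∞} {c : ℝ}
    (hfg : ∀ᵐ s, g (s + c) = f s) (u : ℝ) : u + c ∈ upperHalfSet g ↔ u ∈ upperHalfSet f := by
  have h1 : ∫⁻ s, g s = ∫⁻ s, f s := by
    rw [← lintegral_add_right_eq_self g c]
    exact lintegral_congr_ae hfg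
  have h2 : ∫⁻ s in Set.Iic (u + c), g s = ∫⁻ s in Set.Iic u, f s := by
    rw [← lintegral_indicator measurableSet_Iic, ← lintegral_indicator measurableSet_Iic,
      ← lintegral_add_right_eq_self _ c]
    refine lintegral_congr_ae (hfg.mono fun s hs => ?_)
    simp only [Set.indicator, Set.mem_Iic, add_le_add_iff_right, hs]
  simp only [upperHalfSet, Set.mem_ofPred_eq, h1, h2]

/-- The median is equivariant under translations. -/
theorem densityMedian_translate {f g : ℝ → ℝ≥0∞} {c : ℝ} (hf0 : ∫⁻ s, f s ≠ 0)
    (hf : ∫⁻ s, f s ≠ ∞) (hfg : ∀ᵐ s, g (s + c) = f s) :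
    densityMedian g = densityMedian f + c := by
  have h1 : IsGLB (upperHalfSet f) (densityMedian f) :=
    isGLB_csInf (nonempty_upperHalfSet hf0 hf) (bddBelow_upperHalfSet hf0 hf)
  have h2 : upperHalfSet g = (OrderIso.addRight c) '' upperHalfSet f := by
    ext v
    rw [OrderIso.image_eq_preimage_symm, Set.mem_preimage, ← mem_upperHalfSet_add_iff hfg]
    simp
  have h3 := (OrderIso.isGLB_image' (f := OrderIso.addRight c)).2 h1
  rw [← h2] at h3
  exact h3.csInf_eq (by
    rw [h2]; exact (nonempty_upperHalfSet hf0 hf).image _)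

/-- Rational witnesses suffice because the half set is an up-set; this makes measurability of the
median a matter of countable unions. -/
theorem densityMedian_lt_iff {f : ℝ → ℝ≥0∞} (hf0 : ∫⁻ s, f s ≠ 0) (hf : ∫⁻ s, f s ≠ ∞) (a : ℝ) :
    densityMedian f < a ↔ ∃ q : ℚ, (q : ℝ) < a ∧ (q : ℝ) ∈ upperHalfSet f := by
  rw [densityMedian, csInf_lt_iff (bddBelow_upperHalfSet hf0 hf) (nonempty_upperHalfSet hf0 hf)]
  constructor
  · rintro ⟨u, hu, hua⟩
    obtain ⟨q, h1, h2⟩ := exists_rat_btwn hua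
    exact ⟨q, h2, upperHalfSet_mono h1.le hu⟩
  · rintro ⟨q, h1, h2⟩
    exact ⟨q, h2, h1⟩

/-- The median of a measurable family of densities, defined as `0` where it is degenerate, is
measurable. -/
theorem measurable_densityMedian {Ω : Type*} [MeasurableSpace Ω] {f : Ω → ℝ → ℝ≥0∞}
    (hf : Measurable (Function.uncurry f)) (G : Set Ω) (hG : MeasurableSet G)
    (hG' : ∀ ω ∈ G, ∫⁻ s, f ω s ≠ 0 ∧ ∫⁻ s, f ω s ≠ ∞) [DecidablePred (· ∈ G)] :
    Measurable fun ω => if ω ∈ G then densityMedian (f ω) else 0 := by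
  refine measurable_of_Iio fun a => ?_
  have h1 : ∀ u : ℝ, MeasurableSet {ω | u ∈ upperHalfSet (f ω)} := fun u =>
    measurableSet_le hf.lintegral_prod_right' (hf.lintegral_prod_right'.const_mul _)
  have h2 : ((fun ω => if ω ∈ G then densityMedian (f ω) else 0) ⁻¹' Set.Iio a) =
      (G ∩ ⋃ q : ℚ, {ω | (q : ℝ) < a} ∩ {ω | (q : ℝ) ∈ upperHalfSet (f ω)}) ∪
        (Gᶜ ∩ {ω | 0 < a}) := by
    ext ω
    by_cases hω : ω ∈ G
    · simp [hω, densityMedian_lt_iff (hG' ω hω).1 (hG' ω hω).2]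
    · simp [hω]
  rw [h2]
  exact (hG.inter (MeasurableSet.iUnion fun q : ℚ => (MeasurableSet.const _).inter (h1 (q : ℝ)))).union
    (hG.compl.inter (MeasurableSet.const _))

end Median

/-! ### Schmidt's theorem: tight cocycles are coboundaries. -/

section Coboundary

open scoped ENNReal

variable {Ω : Type*} [MeasurableSpace Ω] {P : Measure Ω} [IsProbabilityMeasure P]

/-- The skew product of a measure preserving map with translations of the line. -/
theorem measurePreserving_skew_translation {T : Ω → Ω} (hT : MeasurePreserving T P P)
    {c : Ω → ℝ} (hc : Measurable c) :
    MeasurePreserving (fun z : Ω × ℝ => (T z.1, z.2 + c z.1)) (P.prod volume) (P.prod volume) :=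
  hT.skew_product (g := fun ω s => s + c ω) (by fun_prop)
    (ae_of_all _ fun ω => map_add_right_eq_self volume (c ω))

theorem memLp_exp_neg_sq :
    MemLp (fun z : Ω × ℝ => Real.exp (-z.2 ^ 2)) 2 (P.prod volume) := by
  have hm : Measurable fun z : Ω × ℝ => Real.exp (-z.2 ^ 2) := by fun_prop
  rw [memLp_two_iff_integrable_sq hm.aestronglyMeasurable]
  have h1 : Integrable (fun s : ℝ => Real.exp (-s ^ 2) ^ 2) := by
    have := integrable_exp_neg_mul_sq (b := 2) (by norm_num)
    refine this.congr (ae_of_all _ fun s => ?_)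
    simp only [← Real.exp_nat_mul]
    congr 1
    push_cast
    ring
  exact h1.comp_snd P

/-- Lower bound for the mass that a translated Gaussian bump leaves over a product set. -/
theorem le_setIntegral_exp_neg_sq {c : Ω → ℝ} (hc : Measurable c) {B : Set Ω}
    (hB : MeasurableSet B) (K : ℝ) :
    Real.exp (-(K + 1) ^ 2) * (P.real B - P.real {ω | K ≤ |c ω|}) ≤
      ∫ z in B ×ˢ Set.Icc (0 : ℝ) 1, Real.exp (-(z.2 + c z.1) ^ 2) ∂(P.prod volume) := by
  have hA : MeasurableSet {ω | K ≤ |c ω|} := measurableSet_le measurable_const hc.abs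
  set A := {ω | K ≤ |c ω|} with hAdef
  have hm : Measurable fun z : Ω × ℝ => Real.exp (-(z.2 + c z.1) ^ 2) := by fun_prop
  have hfin : ∀ C : Set Ω, (P.prod volume) (C ×ˢ Set.Icc (0 : ℝ) 1) ≠ ∞ := fun C => by
    rw [Measure.prod_prod]
    simp
  have hint : IntegrableOn (fun z : Ω × ℝ => Real.exp (-(z.2 + c z.1) ^ 2))
      (B ×ˢ Set.Icc (0 : ℝ) 1) (P.prod volume) := by
    refine Measure.integrableOn_of_bounded (M := 1) (hfin B) hm.aestronglyMeasurable
      (ae_of_all _ fun z => ?_)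
    rw [Real.norm_eq_abs, abs_of_pos (Real.exp_pos _), Real.exp_le_one_iff]
    nlinarith [sq_nonneg (z.2 + c z.1)]
  have hsub : (B \ A) ×ˢ Set.Icc (0 : ℝ) 1 ⊆ B ×ˢ Set.Icc (0 : ℝ) 1 :=
    Set.prod_mono Set.sdiff_subset subset_rfl
  calc Real.exp (-(K + 1) ^ 2) * (P.real B - P.real A)
      ≤ Real.exp (-(K + 1) ^ 2) * P.real (B \ A) := by
        gcongr
        exact le_measureReal_sdiff
    _ = ∫ z in (B \ A) ×ˢ Set.Icc (0 : ℝ) 1, Real.exp (-(K + 1) ^ 2) ∂(P.prod volume) := by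
        rw [setIntegral_const, measureReal_prod_prod]
        simp [mul_comm]
    _ ≤ ∫ z in (B \ A) ×ˢ Set.Icc (0 : ℝ) 1, Real.exp (-(z.2 + c z.1) ^ 2) ∂(P.prod volume) := by
        refine setIntegral_mono_on (integrableOn_const (hfin _)) (hint.mono_set hsub)
          ((hB.diff hA).prod measurableSet_Icc) fun z hz => ?_
        -- Off `A`, with `s ∈ [0, 1]`, one has `|s + c| ≤ K + 1`.
        have h1 : |c z.1| < K := not_le.1 hz.1.2
        have h2 := hz.2
        rw [Real.exp_le_exp, neg_le_neg_iff]
        rw [abs_lt] at h1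
        exact sq_le_sq' (by linarith [h2.1]) (by linarith [h2.2])
    _ ≤ _ := setIntegral_mono_set hint (ae_of_all _ fun z => (Real.exp_pos _).le)
        hsub.eventuallyLE

variable {G : Type*} [AddMonoid G]

/-- A tight real cocycle over a measure preserving action admits a square integrable function
that is invariant under all skew products and does not vanish on any fibre. -/
theorem exists_invariant_density {T : G → Ω → Ω} (hT : ∀ x, MeasurePreserving (T x) P P)
    (hTadd : ∀ x y ω, T (x + y) ω = T x (T y ω)) {c : G → Ω → ℝ} (hc : ∀ x, Measurable (c x))
    (hcadd : ∀ x y ω, c (x + y) ω = c y ω + c x (T y ω)) {p : ℝ → ℝ}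
    (hp : Tendsto p atTop (𝓝 0)) (htight : ∀ x, ∀ t > 0, P.real {ω | t ≤ |c x ω|} ≤ p t) :
    ∃ f : Ω × ℝ → ℝ, Measurable f ∧ MemLp f 2 (P.prod volume) ∧
      (∀ x, ∀ᵐ z ∂(P.prod volume), f (T x z.1, z.2 + c x z.1) = f z) ∧
      ∀ᵐ ω ∂P, ¬ ∀ᵐ s, f (ω, s) = 0 := by
  set μ := P.prod (volume : Measure ℝ) with hμ
  set Φ : G → Ω × ℝ → Ω × ℝ := fun x z => (T x z.1, z.2 + c x z.1) with hΦ
  have hΦm : ∀ x, MeasurePreserving (Φ x) μ μ := fun x =>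
    measurePreserving_skew_translation (hT x) (hc x)
  have hΦadd : ∀ x y, Φ x ∘ Φ y = Φ (x + y) := fun x y => by
    funext z
    simp only [hΦ, Function.comp, hTadd, hcadd, add_assoc]
  let φ : Ω × ℝ → ℝ := fun z => Real.exp (-z.2 ^ 2)
  have hφ : MemLp φ 2 μ := memLp_exp_neg_sq
  have hφx : ∀ x, MemLp (φ ∘ Φ x) 2 μ := fun x => hφ.comp_measurePreserving (hΦm x)
  let V : G → Lp ℝ 2 μ →ₗᵢ[ℝ] Lp ℝ 2 μ := fun x => Lp.compMeasurePreservingₗᵢ ℝ (Φ x) (hΦm x)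
  let S : Set (Lp ℝ 2 μ) := Set.range fun x => (hφx x).toLp _
  obtain ⟨h, hhS, hinv⟩ := exists_fixed_mem_closedConvexHull (S := S)
    (Set.range_nonempty (ι := G) _) V (by
      rintro y _ ⟨x, rfl⟩
      refine ⟨x + y, ?_⟩
      have : V y ((hφx x).toLp _) = ((hφx x).comp_measurePreserving (hΦm y)).toLp _ := rfl
      simp only [this, Function.comp_assoc, hΦadd])
  -- By tightness the bound holds on the whole orbit with the same constant. It is a closed
  -- half-space condition, so it passes to the closed convex hull.
  have hlow : ∀ B, MeasurableSet B → ∀ K > 0,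
      Real.exp (-(K + 1) ^ 2) * (P.real B - p K) ≤ ∫ z in B ×ˢ Set.Icc (0 : ℝ) 1, h z ∂μ := by
    intro B hB K hK
    have hs : MeasurableSet (B ×ˢ Set.Icc (0 : ℝ) 1) := hB.prod measurableSet_Icc
    have hμs : μ (B ×ˢ Set.Icc (0 : ℝ) 1) ≠ ∞ := by
      rw [hμ, Measure.prod_prod]
      simp
    rw [← L2.inner_indicatorConstLp_one (𝕜 := ℝ) hs hμs]
    set e := indicatorConstLp 2 hs hμs (1 : ℝ)
    have hsub : closedConvexHull ℝ S ⊆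
        {f | Real.exp (-(K + 1) ^ 2) * (P.real B - p K) ≤ inner ℝ e f} := by
      refine closedConvexHull_min ?_
        (convex_halfSpace_ge (innerSL ℝ e).toLinearMap.isLinear _)
        (isClosed_le continuous_const (innerSL ℝ e).continuous)
      rintro _ ⟨x, rfl⟩
      rw [Set.mem_ofPred_eq, L2.inner_indicatorConstLp_one (𝕜 := ℝ) hs hμs,
        setIntegral_congr_ae (g := fun z => Real.exp (-(z.2 + c x z.1) ^ 2)) hs
          ((hφx x).coeFn_toLp.mono fun z hz _ => hz)]
      refine le_trans ?_ (le_setIntegral_exp_neg_sq (hc x) hB K)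
      gcongr
      exact htight x K hK
    exact hsub hhS
  obtain ⟨f, hfm, hf⟩ := (Lp.aestronglyMeasurable h).aemeasurable
  refine ⟨f, hfm, (memLp_congr_ae hf).1 (Lp.memLp h), fun x => ?_, ?_⟩
  · have h1 := Lp.coeFn_compMeasurePreserving h (hΦm x)
    have h2 : Lp.compMeasurePreserving (Φ x) (hΦm x) h = h := hinv x
    rw [h2] at h1
    filter_upwards [h1, hf, (hΦm x).quasiMeasurePreserving.ae hf] with z hz1 hz2 hz3
    rw [← hz2, hz1, Function.comp, hz3]
  · set B := {ω | ∀ᵐ s, f (ω, s) = 0} with hBdef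
    have hBm : MeasurableSet B := by
      have : B = {ω | ∫⁻ s, ‖f (ω, s)‖ₑ = 0} := by
        ext ω
        rw [Set.mem_ofPred_eq, Set.mem_ofPred_eq, lintegral_eq_zero_iff (by fun_prop)]
        simp [EventuallyEq]
      rw [this]
      exact (Measurable.lintegral_prod_right' (f := fun z => ‖f z‖ₑ) hfm.enorm)
        (measurableSet_singleton 0)
    have hzero : ∫ z in B ×ˢ Set.Icc (0 : ℝ) 1, h z ∂μ = 0 := by
      rw [setIntegral_congr_ae (g := fun z => f z) (hBm.prod measurableSet_Icc)
        (hf.mono fun z hz _ => hz)]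
      refine setIntegral_eq_zero_of_ae_eq_zero ?_
      have hms : MeasurableSet {z : Ω × ℝ | z ∈ B ×ˢ Set.Icc (0 : ℝ) 1 → f z = 0} := by
        have : {z : Ω × ℝ | z ∈ B ×ˢ Set.Icc (0 : ℝ) 1 → f z = 0} =
            (B ×ˢ Set.Icc (0 : ℝ) 1)ᶜ ∪ f ⁻¹' {0} := by
          ext z
          simp [imp_iff_not_or]
        rw [this]
        exact (hBm.prod measurableSet_Icc).compl.union (hfm (measurableSet_singleton 0))
      rw [hμ, Measure.ae_prod_iff_ae_ae hms]
      refine ae_of_all _ fun ω => ?_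
      by_cases hω : ω ∈ B
      · filter_upwards [hω] with s hs _ using hs
      · exact ae_of_all _ fun s hs => absurd hs.1 hω
    -- Over the set `B` of vanishing fibres the integral in `hlow` is zero; letting `K → ∞` leaves
    -- `P(B) = 0`.
    have hBp : ∀ K > 0, P.real B ≤ p K := fun K hK => by
      have := hlow B hBm K hK
      rw [hzero] at this
      have h2 := nonpos_of_mul_nonpos_right this (Real.exp_pos _)
      linarith
    have hB0 : P.real B ≤ 0 :=
      ge_of_tendsto hp ((eventually_gt_atTop 0).mono hBp)
    rw [ae_iff]
    simp only [not_not]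
    exact (measureReal_eq_zero_iff).1 (le_antisymm hB0 measureReal_nonneg)

/-- **Schmidt's theorem**: a tight real cocycle over a probability measure preserving action is
a coboundary. -/
theorem exists_coboundary_of_tight {T : G → Ω → Ω} (hT : ∀ x, MeasurePreserving (T x) P P)
    (hTadd : ∀ x y ω, T (x + y) ω = T x (T y ω)) {c : G → Ω → ℝ} (hc : ∀ x, Measurable (c x))
    (hcadd : ∀ x y ω, c (x + y) ω = c y ω + c x (T y ω)) {p : ℝ → ℝ}
    (hp : Tendsto p atTop (𝓝 0)) (htight : ∀ x, ∀ t > 0, P.real {ω | t ≤ |c x ω|} ≤ p t) :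
    ∃ m : Ω → ℝ, Measurable m ∧ ∀ x, ∀ᵐ ω ∂P, m (T x ω) = m ω + c x ω := by
  classical
  obtain ⟨f, hfm, hf2, hinv, hne⟩ := exists_invariant_density hT hTadd hc hcadd hp htight
  let g : Ω → ℝ → ℝ≥0∞ := fun ω s => ‖f (ω, s)‖ₑ ^ 2
  have hgm : Measurable (Function.uncurry g) := hfm.enorm.pow_const 2
  have hI : Measurable fun ω => ∫⁻ s, g ω s := hgm.lintegral_prod_right'
  let D : Set Ω := {ω | ∫⁻ s, g ω s ≠ 0 ∧ ∫⁻ s, g ω s ≠ ∞}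
  have hDm : MeasurableSet D :=
    (hI (measurableSet_singleton 0)).compl.inter (hI (measurableSet_singleton ∞)).compl
  -- Fibre masses are finite by Tonelli, since `f` is in `L²`, and nonzero by `hne`.
  have hD : ∀ᵐ ω ∂P, ω ∈ D := by
    have hfin : ∫⁻ ω, (∫⁻ s, g ω s) ∂P ≠ ∞ := by
      have h1 := lintegral_prod (μ := P) (ν := (volume : Measure ℝ)) _ hgm.aemeasurable
      have h2 : ∫⁻ ω, (∫⁻ s, g ω s) ∂P = ∫⁻ z, ‖f z‖ₑ ^ 2 ∂(P.prod volume) := h1.symm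
      rw [h2]
      have h3 := (eLpNorm_lt_top_iff_lintegral_rpow_enorm_lt_top two_ne_zero
        ENNReal.ofNat_ne_top).1 hf2.2
      simpa using h3.ne
    filter_upwards [hne, ae_lt_top hI hfin] with ω h1 h2
    refine ⟨fun h0 => h1 ?_, h2.ne⟩
    rw [lintegral_eq_zero_iff (show Measurable (g ω) from hgm.comp measurable_prodMk_left)] at h0
    filter_upwards [h0] with s hs
    simpa [g] using hs
  refine ⟨fun ω => if ω ∈ D then densityMedian (g ω) else 0,
    measurable_densityMedian hgm D hDm fun ω hω => hω, fun x => ?_⟩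
  filter_upwards [hD, (hT x).quasiMeasurePreserving.ae hD, Measure.ae_ae_of_ae_prod (hinv x)]
    with ω h1 h2 h3
  rw [if_pos h1, if_pos h2]
  refine densityMedian_translate h1.1 h1.2 (h3.mono fun s hs => ?_)
  simp only [g, hs]

end Coboundary

/-! ### Removing the dependence of null sets on time. -/

section Perfection

variable {Ω : Type*} [MeasurableSpace Ω] {P : Measure Ω} [IsProbabilityMeasure P]

/-- The constant value of `u`, if `u` is almost everywhere constant. -/
noncomputable def aeConstValue (u : ℝ → ℝ) : ℝ :=
  Real.tan (∫ x in Set.Icc (0 : ℝ) 1, Real.arctan (u x))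

/-- The interval has length one and `tan` inverts `arctan`. Averaging the bounded `arctan ∘ u` gives
a measurable formula that needs no integrability of `u`. -/
theorem aeConstValue_eq {u : ℝ → ℝ} {k : ℝ} (hu : ∀ᵐ x, u x = k) : aeConstValue u = k := by
  have h : ∫ x in Set.Icc (0 : ℝ) 1, Real.arctan (u x) =
      ∫ _ in Set.Icc (0 : ℝ) 1, Real.arctan k :=
    integral_congr_ae (ae_restrict_of_ae (hu.mono fun x hx => by simp only [hx]))
  rw [aeConstValue, h, setIntegral_const]
  simp [Real.tan_arctan]

theorem measurable_aeConstValue {u : Ω → ℝ → ℝ} (hu : Measurable (Function.uncurry u)) :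
    Measurable fun ω => aeConstValue (u ω) := by
  have h1 : Measurable fun z : Ω × ℝ => Real.arctan (u z.1 z.2) :=
    Real.continuous_arctan.measurable.comp hu
  have h2 := (h1.stronglyMeasurable.integral_prod_right'
    (ν := volume.restrict (Set.Icc (0 : ℝ) 1))).measurable
  have h3 : Measurable Real.tan := by
    have : Real.tan = fun x => Real.sin x / Real.cos x := funext Real.tan_eq_sin_div_cos
    rw [this]
    exact Real.measurable_sin.div Real.measurable_cos
  exact h3.comp h2

/-- A transfer function of a cocycle over a measurable flow can be modified so that the cobounding
identity holds simultaneously for all times. -/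
theorem exists_perfect_coboundary {T : ℝ → Ω → Ω}
    (hT : Measurable fun z : Ω × ℝ => T z.2 z.1)
    (hTadd : ∀ x y ω, T (x + y) ω = T x (T y ω)) {c : ℝ → Ω → ℝ}
    (hc : Measurable fun z : Ω × ℝ => c z.2 z.1)
    (hcadd : ∀ x y ω, c (x + y) ω = c y ω + c x (T y ω)) {m : Ω → ℝ} (hm : Measurable m)
    (hmc : ∀ x, ∀ᵐ ω ∂P, m (T x ω) = m ω + c x ω) :
    ∃ g : Ω → ℝ, Measurable g ∧ ∀ᵐ ω ∂P, ∀ x, g (T x ω) = g ω + c x ω := by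
  have hu : Measurable (Function.uncurry fun ω x => m (T x ω) - c x ω) := (hm.comp hT).sub hc
  -- Fubini exchanges "every `x`, almost every `ω`" for "almost every `ω`, almost every `x`".
  have hconst : ∀ᵐ ω ∂P, ∀ᵐ x, m (T x ω) - c x ω = m ω := by
    rw [Measure.ae_ae_comm (p := fun ω x => m (T x ω) - c x ω = m ω)
      (measurableSet_eq_fun hu (hm.comp measurable_fst))]
    exact ae_of_all _ fun x => (hmc x).mono fun ω hω => by rw [hω, add_sub_cancel_right]
  refine ⟨fun ω => aeConstValue fun x => m (T x ω) - c x ω, measurable_aeConstValue hu, ?_⟩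
  filter_upwards [hconst] with ω hω y
  rw [aeConstValue_eq hω]
  refine aeConstValue_eq ?_
  -- With `u_ω(x) = m(T_x ω) - c_x(ω)`, the cocycle identity gives `u_{T_y ω}(x) = u_ω(x + y) +
  -- c_y(ω)`. Translation by `y` preserves null sets, so every `y` works for the same `ω`.
  filter_upwards [(measurePreserving_add_right volume y).quasiMeasurePreserving.ae hω] with x hx
  rw [← hTadd, ← hx, hcadd x y]
  ring

end Perfection

/-! ### Distribution functions and measurability of the translation flow. -/

namespace LocSignedMeasure

theorem measurable_eval (s : Set ℝ) : Measurable fun ω : LocSignedMeasure => ω.toFun s :=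
  measurable_iff_comap_le.2 (le_iSup
    (fun s : Set ℝ => MeasurableSpace.comap (fun ω : LocSignedMeasure => ω.toFun s) inferInstance) s)

theorem measurable_F (a b : ℝ) : Measurable fun ω => F ω a b := measurable_eval _

theorem measurable_of_eval {α : Type*} [MeasurableSpace α] {f : α → LocSignedMeasure}
    (hf : ∀ s, MeasurableSet s → Bornology.IsBounded s → Measurable fun z => (f z).toFun s) :
    Measurable f := by
  refine measurable_iff_le_map.2 (iSup_le fun s => MeasurableSpace.comap_le_iff_le_map.2 ?_)
  rw [MeasurableSpace.map_comp, ← measurable_iff_le_map]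
  by_cases hs : MeasurableSet s ∧ Bornology.IsBounded s
  · exact hf s hs.1 hs.2
  · have : (fun ω : LocSignedMeasure => ω.toFun s) ∘ f = fun _ => 0 :=
      funext fun z => (f z).eq_zero_of_not s hs
    rw [this]
    exact measurable_const

theorem toFun_empty (ω : LocSignedMeasure) : ω.toFun ∅ = 0 := by
  have h := ω.hasSum_iUnion (fun _ => ∅) (fun _ => MeasurableSet.empty)
    (fun _ _ _ => disjoint_bot_left) (by simp)
  exact (summable_const_iff _).1 h.summable

open Classical in
/-- The restriction of a locally finite signed measure to a bounded Borel set. -/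
noncomputable def restrict (ω : LocSignedMeasure) (B : Set ℝ) (hB : MeasurableSet B)
    (hb : Bornology.IsBounded B) : SignedMeasure ℝ where
  measureOf' s := if MeasurableSet s then ω.toFun (s ∩ B) else 0
  empty' := by simp [toFun_empty]
  not_measurable' s hs := if_neg hs
  m_iUnion' f hf hd := by
    simp only [hf, MeasurableSet.iUnion hf, if_true, Set.iUnion_inter]
    refine ω.hasSum_iUnion _ (fun i => (hf i).inter hB)
      (fun i j hij => (hd hij).mono Set.inter_subset_left Set.inter_subset_left)
      (hb.subset (Set.iUnion_subset fun i => Set.inter_subset_right))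

theorem restrict_apply (ω : LocSignedMeasure) {B : Set ℝ} (hB : MeasurableSet B)
    (hb : Bornology.IsBounded B) {s : Set ℝ} (hs : MeasurableSet s) :
    ω.restrict B hB hb s = ω.toFun (s ∩ B) := if_pos hs

theorem F_eq_zero (ω : LocSignedMeasure) {a b : ℝ} (h : b ≤ a) : F ω a b = 0 := by
  rw [F, Set.Ioc_eq_empty (not_lt.2 h), toFun_empty]

theorem F_add (ω : LocSignedMeasure) {a b d : ℝ} (hab : a ≤ b) (hbd : b ≤ d) :
    F ω a b + F ω b d = F ω a d := by
  have hB : MeasurableSet (Set.Ioc a d) := measurableSet_Ioc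
  have hb : Bornology.IsBounded (Set.Ioc a d) := Metric.isBounded_Ioc a d
  have h := VectorMeasure.of_union (v := ω.restrict _ hB hb)
    (Set.Ioc_disjoint_Ioc_of_le (a := a) (d := d) (le_refl b)) measurableSet_Ioc
    measurableSet_Ioc
  rw [Set.Ioc_union_Ioc_eq_Ioc hab hbd, restrict_apply _ _ _ measurableSet_Ioc,
    restrict_apply _ _ _ measurableSet_Ioc, restrict_apply _ _ _ measurableSet_Ioc,
    Set.inter_self, Set.inter_eq_left.2 (Set.Ioc_subset_Ioc_right hbd),
    Set.inter_eq_left.2 (Set.Ioc_subset_Ioc_left hab)] at h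
  exact h.symm

/-- The distribution function of a locally finite signed measure, normalized to vanish at `0`. -/
noncomputable def primitive (x : ℝ) (ω : LocSignedMeasure) : ℝ :=
  if 0 ≤ x then F ω 0 x else -F ω x 0

theorem F_eq_primitive_sub (ω : LocSignedMeasure) {a b : ℝ} (hab : a ≤ b) :
    F ω a b = primitive b ω - primitive a ω := by
  rcases le_or_gt 0 a with ha | ha
  · rw [primitive, primitive, if_pos ha, if_pos (ha.trans hab), ← F_add ω ha hab]
    ring
  · rcases le_or_gt 0 b with hb | hb
    · rw [primitive, primitive, if_pos hb, if_neg ha.not_ge, ← F_add ω ha.le hb]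
      ring
    · rw [primitive, primitive, if_neg hb.not_ge, if_neg ha.not_ge, ← F_add ω hab hb.le]
      ring

theorem primitive_zero (ω : LocSignedMeasure) : primitive 0 ω = 0 := by
  rw [primitive, if_pos le_rfl, F_eq_zero ω le_rfl]

theorem measurable_primitive (x : ℝ) : Measurable (primitive x) := by
  unfold primitive
  split_ifs
  · exact measurable_F _ _
  · exact (measurable_F _ _).neg

theorem F_shift (x : ℝ) (ω : LocSignedMeasure) (a b : ℝ) :
    F (shift x ω) a b = F ω (a + x) (b + x) := by
  simp [F, shift]

theorem shift_add (x y : ℝ) (ω : LocSignedMeasure) : shift (x + y) ω = shift x (shift y ω) := by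
  ext s
  simp only [shift, Set.preimage_preimage]
  congr 2
  funext z
  ring

theorem shift_zero (ω : LocSignedMeasure) : shift 0 ω = ω := by
  ext s
  simp [shift]

theorem primitive_add (x y : ℝ) (ω : LocSignedMeasure) :
    primitive (x + y) ω = primitive y ω + primitive x (shift y ω) := by
  rcases le_or_gt 0 x with hx | hx
  · rw [primitive.eq_1 x, if_pos hx, F_shift, F_eq_primitive_sub ω (by linarith), zero_add]
    ring
  · rw [primitive.eq_1 x, if_neg hx.not_ge, F_shift, F_eq_primitive_sub ω (by linarith), zero_add]
    ring

/-- The distribution function is right continuous along decreasing sequences. -/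
theorem tendsto_primitive_of_antitone (ω : LocSignedMeasure) {u : ℕ → ℝ} {x : ℝ}
    (hu : Antitone u) (hxu : ∀ n, x < u n) (hlim : Tendsto u atTop (𝓝 x)) :
    Tendsto (fun n => primitive (u n) ω) atTop (𝓝 (primitive x ω)) := by
  have hU : ⋃ n, Set.Ioc (u (n + 1)) (u n) = Set.Ioc x (u 0) := by
    ext y
    rw [Set.mem_iUnion]
    constructor
    · rintro ⟨n, h1, h2⟩
      exact ⟨(hxu _).trans h1, h2.trans (hu (Nat.zero_le n))⟩
    · rintro ⟨h1, h2⟩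
      classical
      have hex : ∃ n, u n < y := (hlim.eventually (gt_mem_nhds h1)).exists
      -- The first index with `u n < y` is not `0`, because `y ≤ u 0`; its predecessor `k` gives the
      -- interval containing `y`.
      obtain ⟨k, hk⟩ := Nat.exists_eq_succ_of_ne_zero
        (show Nat.find hex ≠ 0 from fun h0 => by
          have := Nat.find_spec hex
          rw [h0] at this
          exact absurd h2 (not_le.2 this))
      refine ⟨k, ?_, ?_⟩
      · have := Nat.find_spec hex
        rwa [hk] at this
      · exact not_lt.1 (Nat.find_min hex (by omega))
  have h := ω.hasSum_iUnion (fun n => Set.Ioc (u (n + 1)) (u n)) (fun _ => measurableSet_Ioc)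
    hu.pairwise_disjoint_on_Ioc_succ (by rw [hU]; exact Metric.isBounded_Ioc _ _)
  rw [hU] at h
  have h2 : ∀ n, ω.toFun (Set.Ioc (u (n + 1)) (u n)) =
      primitive (u n) ω - primitive (u (n + 1)) ω := fun n =>
    F_eq_primitive_sub ω (hu (Nat.le_succ n))
  have h3 : ω.toFun (Set.Ioc x (u 0)) = primitive (u 0) ω - primitive x ω :=
    F_eq_primitive_sub ω (hxu 0).le
  rw [h3] at h
  simp only [h2] at h
  have h4 := h.tendsto_sum_nat
  simp only [Finset.sum_range_sub'] at h4
  have h5 := h4.const_sub (primitive (u 0) ω)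
  simpa using h5

/-- The least dyadic number of level `n` above `x`. -/
noncomputable def dyadicAbove (n : ℕ) (x : ℝ) : ℝ := (⌊2 ^ n * x⌋ + 1 : ℤ) / 2 ^ n

theorem lt_dyadicAbove (n : ℕ) (x : ℝ) : x < dyadicAbove n x := by
  rw [dyadicAbove, lt_div_iff₀ (by positivity), mul_comm]
  push_cast
  exact Int.lt_floor_add_one _

theorem dyadicAbove_le (n : ℕ) (x : ℝ) : dyadicAbove n x ≤ x + (1 / 2) ^ n := by
  rw [dyadicAbove, div_le_iff₀ (by positivity), add_mul, ← mul_pow]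
  push_cast
  have := Int.floor_le (2 ^ n * x)
  norm_num
  linarith

theorem antitone_dyadicAbove (x : ℝ) : Antitone fun n => dyadicAbove n x := by
  refine antitone_nat_of_succ_le fun n => ?_
  have h1 : ⌊2 ^ (n + 1) * x⌋ + 1 ≤ 2 * (⌊2 ^ n * x⌋ + 1) := by
    rw [Int.add_one_le_iff, Int.floor_lt]
    push_cast
    have := Int.lt_floor_add_one (2 ^ n * x)
    rw [pow_succ]
    linarith
  have h2 : ((⌊2 ^ (n + 1) * x⌋ + 1 : ℤ) : ℝ) ≤ 2 * ((⌊2 ^ n * x⌋ + 1 : ℤ) : ℝ) := by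
    exact_mod_cast h1
  rw [dyadicAbove, dyadicAbove, div_le_div_iff₀ (by positivity) (by positivity)]
  calc ((⌊2 ^ (n + 1) * x⌋ + 1 : ℤ) : ℝ) * 2 ^ n
      ≤ 2 * ((⌊2 ^ n * x⌋ + 1 : ℤ) : ℝ) * 2 ^ n := by gcongr
    _ = ((⌊2 ^ n * x⌋ + 1 : ℤ) : ℝ) * 2 ^ (n + 1) := by ring

theorem tendsto_dyadicAbove (x : ℝ) : Tendsto (fun n => dyadicAbove n x) atTop (𝓝 x) := by
  refine tendsto_of_tendsto_of_tendsto_of_le_of_le tendsto_const_nhds ?_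
    (fun n => (lt_dyadicAbove n x).le) (fun n => dyadicAbove_le n x)
  simpa using (tendsto_pow_atTop_nhds_zero_of_lt_one (r := (1 / 2 : ℝ)) (by norm_num)
    (by norm_num)).const_add x

/-- Right continuity reduces joint measurability to dyadic arguments, of which each level has only
countably many. -/
theorem measurable_primitive_uncurry :
    Measurable fun z : LocSignedMeasure × ℝ => primitive z.2 z.1 := by
  have hlim : ∀ z : LocSignedMeasure × ℝ,
      Tendsto (fun n => primitive (dyadicAbove n z.2) z.1) atTop (𝓝 (primitive z.2 z.1)) :=
    fun z => tendsto_primitive_of_antitone z.1 (antitone_dyadicAbove z.2)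
      (fun n => lt_dyadicAbove n z.2) (tendsto_dyadicAbove z.2)
  refine measurable_of_tendsto_metrizable (fun n => ?_) (tendsto_pi_nhds.2 hlim)
  have h1 : Measurable fun z : LocSignedMeasure × ℤ => primitive ((z.2 : ℝ) / 2 ^ n) z.1 :=
    measurable_from_prod_countable_left fun k : ℤ =>
      measurable_primitive ((k : ℝ) / 2 ^ n)
  have h2 : Measurable fun z : LocSignedMeasure × ℝ => (z.1, ⌊2 ^ n * z.2⌋ + 1) :=
    measurable_fst.prodMk ((Int.measurable_floor.comp (measurable_snd.const_mul _)).add_const 1)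
  exact h1.comp h2

theorem measurable_F_shift (a b : ℝ) :
    Measurable fun z : LocSignedMeasure × ℝ => F (shift z.2 z.1) a b := by
  rcases le_or_gt a b with hab | hab
  · have : (fun z : LocSignedMeasure × ℝ => F (shift z.2 z.1) a b) =
        fun z => primitive (b + z.2) z.1 - primitive (a + z.2) z.1 := by
      funext z
      rw [F_shift, F_eq_primitive_sub _ (by linarith)]
    rw [this]
    have h : ∀ r : ℝ, Measurable fun z : LocSignedMeasure × ℝ => (z.1, r + z.2) := fun r => by
      fun_prop
    exact (measurable_primitive_uncurry.comp (h b)).sub (measurable_primitive_uncurry.comp (h a))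
  · simp only [F_eq_zero _ hab.le]
    exact measurable_const

/-- A π-λ argument: half-lines reduce to the distribution function, and restricting to a bounded `B
⊇ s` yields a finite signed measure, for which complements make sense. -/
theorem measurable_shift_uncurry :
    Measurable fun z : LocSignedMeasure × ℝ => shift z.2 z.1 := by
  refine measurable_of_eval fun s hs hb => ?_
  obtain ⟨R, hR⟩ := hb.subset_closedBall 0
  -- The left end is moved past `-R` because the interval is open there.
  set B := Set.Ioc (-(R + 1)) R with hBdef
  have hBm : MeasurableSet B := measurableSet_Ioc
  have hBb : Bornology.IsBounded B := Metric.isBounded_Ioc _ _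
  have hsB : s ⊆ B := fun y hy => by
    have := hR hy
    rw [Metric.mem_closedBall, dist_zero_right, Real.norm_eq_abs, abs_le] at this
    exact ⟨by linarith, this.2⟩
  have key : ∀ t, MeasurableSet t →
      Measurable fun z : LocSignedMeasure × ℝ => (shift z.2 z.1).restrict B hBm hBb t := by
    intro t ht
    induction t, ht using MeasurableSpace.induction_on_inter (borel_eq_generateFrom_Iic ℝ)
      isPiSystem_Iic with
    | empty => simp
    | basic t ht =>
      obtain ⟨r, rfl⟩ := ht
      simp only [restrict_apply _ hBm hBb measurableSet_Iic]
      rw [Set.inter_comm, hBdef, Set.Ioc_inter_Iic]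
      exact measurable_F_shift _ _
    | compl t ht ih =>
      simp only [VectorMeasure.of_compl ht]
      refine Measurable.sub ?_ ih
      simp only [restrict_apply _ hBm hBb MeasurableSet.univ, Set.univ_inter]
      exact measurable_F_shift _ _
    | iUnion f hd hf ih =>
      refine measurable_of_tendsto_metrizable
        (f := fun n z => ∑ i ∈ Finset.range n, (shift z.2 z.1).restrict B hBm hBb (f i))
        (fun n => Finset.measurable_fun_sum _ fun i _ => ih i) (tendsto_pi_nhds.2 fun z => ?_)
      exact (((shift z.2 z.1).restrict B hBm hBb).m_iUnion hf hd).tendsto_sum_nat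
  have h := key s hs
  simpa only [restrict_apply _ hBm hBb hs, Set.inter_eq_left.2 hsB] using h

theorem measurable_shift (x : ℝ) : Measurable (shift x) :=
  measurable_of_eval fun _ _ _ => measurable_eval _

/-! ### The two implications. -/

variable {P : Measure LocSignedMeasure}

theorem HasTightIntegrals.exists_antiderivative [IsProbabilityMeasure P]
    (hP : IsStationary P) (h : HasTightIntegrals P) :
    ∃ E, IsCovariant E ∧ IsStationaryProcess P E ∧ IsAntiderivative P E := by
  obtain ⟨p, hpa, hp, hpF⟩ := h
  have htight : ∀ x, ∀ t > 0, P.real {ω | t ≤ |primitive x ω|} ≤ p t := by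
    intro x t ht
    rcases lt_trichotomy x 0 with hx | rfl | hx
    · simpa only [primitive, if_neg hx.not_ge, abs_neg] using hpF x 0 hx t
    · have : {ω | t ≤ |primitive 0 ω|} = ∅ := by
        ext ω
        simp [primitive_zero, ht]
      rw [this, measureReal_empty]
      -- An antitone function with limit `0` is nonnegative.
      exact hpa.le_of_tendsto hp t
    · simpa only [primitive, if_pos hx.le] using hpF 0 x hx t
  obtain ⟨m, hm, hmc⟩ := exists_coboundary_of_tight hP shift_add measurable_primitive
    primitive_add hp htight
  obtain ⟨g, hg, hgc⟩ := exists_perfect_coboundary measurable_shift_uncurry shift_add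
    measurable_primitive_uncurry primitive_add hm hmc
  refine ⟨fun ω x => g (shift x ω), fun ω x => by simp only [shift_zero],
    ⟨fun x => hg.comp (measurable_shift x), fun t => ?_⟩, ?_⟩
  · have hmeas : Measurable fun (ω : LocSignedMeasure) (x : ℝ) => g (shift x ω) :=
      measurable_pi_lambda _ fun x => hg.comp (measurable_shift x)
    -- Moving time by `t` amounts to replacing `ω` by `T_t ω`, which leaves `P` unchanged.
    conv_rhs => rw [← (hP t).map_eq]
    rw [Measure.map_map hmeas (hP t).measurable]
    simp only [Function.comp_def, shift_add]
  · filter_upwards [hgc] with ω hω a b hab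
    rw [hω, hω, F_eq_primitive_sub ω hab.le]
    ring

theorem IsStationaryProcess.measureReal_abs_ge {E : LocSignedMeasure → ℝ → ℝ}
    (hE : IsStationaryProcess P E) (x t : ℝ) :
    P.real {ω | t ≤ |E ω x|} = P.real {ω | t ≤ |E ω 0|} := by
  have h1 : ∀ y, Measurable fun (ω : LocSignedMeasure) (z : ℝ) => E ω (z + y) := fun y =>
    measurable_pi_lambda _ fun z => hE.1 _
  have h0 : Measurable fun (ω : LocSignedMeasure) (z : ℝ) => E ω z :=
    measurable_pi_lambda _ fun z => hE.1 _
  have hS : MeasurableSet {v : ℝ → ℝ | t ≤ |v 0|} :=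
    measurableSet_le measurable_const (measurable_pi_apply 0).abs
  have h2 := congrArg (fun ν => ν.real {v : ℝ → ℝ | t ≤ |v 0|}) (hE.2 x)
  simp only [map_measureReal_apply (h1 x) hS, map_measureReal_apply h0 hS] at h2
  simpa using h2

theorem tendsto_measureReal_abs_ge [IsProbabilityMeasure P] {f : LocSignedMeasure → ℝ}
    (hf : Measurable f) :
    Tendsto (fun t : ℝ => P.real {ω | t ≤ |f ω|}) atTop (𝓝 0) := by
  have h := tendsto_measure_iInter_atTop (μ := P) (s := fun t : ℝ => {ω | t ≤ |f ω|})
    (fun t => (measurableSet_le measurable_const hf.abs).nullMeasurableSet)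
    (fun s t hst ω hω => le_trans hst hω) ⟨0, measure_ne_top _ _⟩
  have h2 : ⋂ t : ℝ, {ω | t ≤ |f ω|} = ∅ := by
    refine Set.eq_empty_of_forall_notMem fun ω hω => ?_
    have : |f ω| + 1 ≤ |f ω| := Set.mem_iInter.1 hω (|f ω| + 1)
    linarith
  rw [h2, measure_empty] at h
  exact (ENNReal.tendsto_toReal ENNReal.zero_ne_top).comp h

theorem IsAntiderivative.hasTightIntegrals [IsProbabilityMeasure P]
    {E : LocSignedMeasure → ℝ → ℝ} (hE : IsStationaryProcess P E)
    (hF : IsAntiderivative P E) : HasTightIntegrals P := by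
  -- An increment of size `t` needs an endpoint value of size `t / 2`; by stationarity both
  -- endpoints have the law at time `0`.
  refine ⟨fun t => 2 * P.real {ω | t / 2 ≤ |E ω 0|}, fun s t hst => ?_, ?_, fun a b hab t => ?_⟩
  · refine mul_le_mul_of_nonneg_left (measureReal_mono fun ω hω => ?_) zero_le_two
    exact le_trans (div_le_div_of_nonneg_right hst zero_le_two) hω
  · have := (tendsto_measureReal_abs_ge (P := P) (hE.1 0)).comp
      (tendsto_id.atTop_div_const (zero_lt_two' ℝ))
    simpa using this.const_mul 2
  · have hsub : {ω | t ≤ |F ω a b|} ≤ᵐ[P]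
        ({ω | t / 2 ≤ |E ω b|} ∪ {ω | t / 2 ≤ |E ω a|} : Set LocSignedMeasure) := by
      filter_upwards [hF] with ω hω h
      have h1 : t ≤ |F ω a b| := h
      rw [hω a b hab] at h1
      have h2 := abs_sub (E ω b) (E ω a)
      by_contra hcon
      have h3 : ¬ (t / 2 ≤ |E ω b| ∨ t / 2 ≤ |E ω a|) := hcon
      push Not at h3
      linarith [h3.1, h3.2]
    calc P.real {ω | t ≤ |F ω a b|}
        ≤ P.real ({ω | t / 2 ≤ |E ω b|} ∪ {ω | t / 2 ≤ |E ω a|}) :=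
          ENNReal.toReal_mono (measure_ne_top _ _) (measure_mono_ae hsub)
      _ ≤ P.real {ω | t / 2 ≤ |E ω b|} + P.real {ω | t / 2 ≤ |E ω a|} := measureReal_union_le _ _
      _ = _ := by rw [hE.measureReal_abs_ge, hE.measureReal_abs_ge a, ← two_mul]

end LocSignedMeasure

theorem theorem3 (P : Measure LocSignedMeasure) [IsProbabilityMeasure P]
    (hP : LocSignedMeasure.IsStationary P) :
    (∃ E : LocSignedMeasure → ℝ → ℝ,
      LocSignedMeasure.IsCovariant E ∧ LocSignedMeasure.IsStationaryProcess P E ∧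
        LocSignedMeasure.IsAntiderivative P E) ↔
      LocSignedMeasure.HasTightIntegrals P := by
  constructor
  · rintro ⟨E, -, hE, hF⟩
    exact hF.hasTightIntegrals hE
  · exact fun h => h.exists_antiderivative hP
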